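/- Let $\mathbb{T}\subseteq\mathbb{R}$ be a time scale (a nonempty closed set) with $0,T\in\mathbb{T}$, $T>0$; write $[0,T]_{\mathbb{T}}=\mathbb{T}\cap[0,T]$, $(0,T)_{\mathbb{T}}=\mathbb{T}\cap(0,T)$, and let $\int\cdot\,\triangle s$ denote the Lebesgue delta integral on $\mathbb{T}$ (so that $[a,b)$ has measure $b-a$ for $a\le b$ in $\mathbb{T}$). Let $0<\alpha<\tfrac12$, and let $f:[0,\infty)\to[0,\infty)$ be Lipschitz continuous with Lipschitz constant $L_f\ge 0$ and satisfy $c_1\le f\le c_2$ for positive constants $c_1,c_2$. Assume $$0<\lambda<\left(\frac{T^{2\alpha}L_f}{(c_1T)^2\,\Gamma(2\alpha+1)}+\frac{2c_2^2\,T^{2(\alpha+1)}L_f}{(c_1T)^4\,\Gamma(2\alpha+1)}\right)^{-1},$$ where the right-hand side is read as $+\infty$ if $L_f=0$. Then the nonlocal fractional thermistor problem on $\mathbb{T}$, in its integral form $$u(t)=(Ku)(t):=\frac{\lambda}{\Gamma(2\alpha)}\int_0^t (t-s)^{2\alpha-1}\,\frac{f(u(s))}{\left(\int_0^T f(u(x))\,\triangle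 x\right)^2}\,\triangle s,\qquad t\in[0,T]_{\mathbb{T}},$$ has exactly one solution $u$ among the nonnegative continuous functions on $[0,T]_{\mathbb{T}}$. Moreover, if $[0,T]\subseteq\mathbb{T}$, then this $u$ is also the only nonnegative continuous function on $[0,T]$ that solves the problem in differential form: $${}^{\mathbb{T}}D^{2\alpha}_{0+}u(t)=\frac{\lambda f(u(t))}{\left(\int_0^T f(u(x))\,\triangle x\right)^2}\quad (t\in(0,T)_{\mathbb{T}}),\qquad {}^{\mathbb{T}}I^{\beta}_{0+}u(0)=0\quad\text{for all }\beta\in(0,1),$$ where ${}^{\mathbb{T}}I^{\beta}_{0+}u(t)=\int_0^t\frac{(t-s)^{\beta-1}}{\Gamma(\beta)}u(s)\,\triangle s$ is the left Riemann–Liouville fractional integral and ${}^{\mathbb{T}}D^{2\alpha}_{0+}u=\bigl({}^{\mathbb{T}}I^{1-2\alpha}_{0+}u\bigr)^{\triangle}$ the left Riemann–Liouville fractional derivative on $\mathbb{T}$. -/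

import Mathlib

open Set Filter Topology MeasureTheory
open scoped NNReal ENNReal

namespace TimeScale

noncomputable section

/-! A time scale is a nonempty closed subset `𝕋` of `ℝ`. Functions on a time-scale interval
`[a, b]_𝕋 = 𝕋 ∩ [a, b]` are written as functions `ℝ → ℝ` of which only the values on
`𝕋 ∩ [a, b]` matter. -/

/-- The forward jump operator `σ(t) = inf {s ∈ 𝕋 : s > t}`, with `σ(t) = t` if there is no such
`s` (the usual convention `inf ∅ = sup 𝕋`). -/
def forwardJump (𝕋 : Set ℝ) (t : ℝ) : ℝ :=
  open Classical in if (𝕋 ∩ Ioi t).Nonempty then sInf (𝕋 ∩ Ioi t) else t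

/-- `F` has delta derivative `d` at `t` (Hilger's definition). -/
def HasDeltaDerivAt (𝕋 : Set ℝ) (F : ℝ → ℝ) (d t : ℝ) : Prop :=
  ∀ ε > 0, ∀ᶠ s in 𝓝[𝕋] t,
    |F (forwardJump 𝕋 t) - F s - d * (forwardJump 𝕋 t - s)| ≤ ε * |forwardJump 𝕋 t - s|

/-- The last point of `𝕋` which is not after `s`. -/
def lastPoint (𝕋 : Set ℝ) (s : ℝ) : ℝ := sSup (𝕋 ∩ Iic s)

/-- The real numbers which have a point of `𝕋` at or before them, and one after them. -/
def span (𝕋 : Set ℝ) : Set ℝ := {s | (𝕋 ∩ Iic s).Nonempty ∧ (𝕋 ∩ Ioi s).Nonempty}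

/-- The Lebesgue delta measure of `𝕋`: Lebesgue measure on the part of `𝕋` without gaps, while
the length `σ(t) - t` of a gap is put as a point mass at `t`. It is the measure carried by `𝕋`
with mass `b - a` on `[a, b)` for all `a ≤ b` in `𝕋`; see `deltaMeasure_Ico` and
`deltaMeasure_compl`. -/
def deltaMeasure (𝕋 : Set ℝ) : Measure ℝ := (volume.restrict (span 𝕋)).map (lastPoint 𝕋)

/-- The delta integral `∫_a^b g(s) Δs`, for `a ≤ b` in `𝕋`. -/
def deltaIntegral (𝕋 : Set ℝ) (a b : ℝ) (g : ℝ → ℝ) : ℝ :=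
  ∫ s in Ico a b, g s ∂(deltaMeasure 𝕋)

/-- The left Riemann–Liouville fractional integral of order `β` on the time scale. -/
def fracIntegral (𝕋 : Set ℝ) (a β : ℝ) (g : ℝ → ℝ) (t : ℝ) : ℝ :=
  deltaIntegral 𝕋 a t (fun s => (t - s) ^ (β - 1) / Real.Gamma β * g s)

/-- `d` is the left Riemann–Liouville fractional derivative of order `β` of `g` at `t`. -/
def HasFracDerivAt (𝕋 : Set ℝ) (a β : ℝ) (g : ℝ → ℝ) (d t : ℝ) : Prop :=
  HasDeltaDerivAt 𝕋
    (fun t => deltaIntegral 𝕋 a t (fun s => (t - s) ^ (-β) / Real.Gamma (1 - β) * g s)) d t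

/-- The nonlocal source term `λ f(u(t)) / (∫_0^T f(u) Δx)²`. -/
def source (𝕋 : Set ℝ) (T lam : ℝ) (f u : ℝ → ℝ) (t : ℝ) : ℝ :=
  lam * f (u t) / (deltaIntegral 𝕋 0 T (fun x => f (u x))) ^ 2

/-- The integral operator
`(K u)(t) = λ / Γ(2α) ∫_0^t (t - s)^(2α - 1) f(u(s)) / (∫_0^T f(u) Δx)² Δs`. -/
def operatorK (𝕋 : Set ℝ) (T α lam : ℝ) (f u : ℝ → ℝ) (t : ℝ) : ℝ :=
  lam / Real.Gamma (2 * α) *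
    deltaIntegral 𝕋 0 t (fun s =>
      (t - s) ^ (2 * α - 1) * (f (u s) / (deltaIntegral 𝕋 0 T (fun x => f (u x))) ^ 2))

/-- `u` is a solution of the thermistor problem in integral form: a continuous function on
`[0, T]_𝕋` with values in the domain `[0, ∞)` of `f`, and a fixed point of `K`. -/
structure IsIntegralSolution (𝕋 : Set ℝ) (T α lam : ℝ) (f u : ℝ → ℝ) : Prop where
  continuousOn : ContinuousOn u (𝕋 ∩ Icc 0 T)
  nonneg : ∀ t ∈ 𝕋 ∩ Icc 0 T, 0 ≤ u t
  fixed : ∀ t ∈ 𝕋 ∩ Icc 0 T, u t = operatorK 𝕋 T α lam f u t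

/-- `u` is a solution of the thermistor problem in differential form: a continuous function on
`[0, T]_𝕋` with values in the domain `[0, ∞)` of `f`, such that the Riemann–Liouville derivative
of order `2α` of `u` is the source term on `(0, T)_𝕋`, and the fractional integrals of `u` of
all orders in `(0, 1)` vanish at `0`. -/
structure IsDifferentialSolution (𝕋 : Set ℝ) (T α lam : ℝ) (f u : ℝ → ℝ) : Prop where
  continuousOn : ContinuousOn u (𝕋 ∩ Icc 0 T)
  nonneg : ∀ t ∈ 𝕋 ∩ Icc 0 T, 0 ≤ u t
  equation : ∀ t ∈ 𝕋 ∩ Ioo 0 T,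
    HasFracDerivAt 𝕋 0 (2 * α) u (source 𝕋 T lam f u t) t
  initial : ∀ β ∈ Ioo (0 : ℝ) 1, fracIntegral 𝕋 0 β u 0 = 0

theorem ordConnected_span (𝕋 : Set ℝ) : (span 𝕋).OrdConnected := by
  refine ⟨?_⟩
  rintro x ⟨⟨p, hp, hpx⟩, -⟩ y ⟨-, ⟨q, hq, hyq⟩⟩ z ⟨hxz, hzy⟩
  exact ⟨⟨p, hp, le_trans hpx hxz⟩, ⟨q, hq, lt_of_le_of_lt hzy hyq⟩⟩

theorem aemeasurable_lastPoint (𝕋 : Set ℝ) :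
    AEMeasurable (lastPoint 𝕋) (volume.restrict (span 𝕋)) := by
  refine aemeasurable_restrict_of_monotoneOn (ordConnected_span 𝕋).measurableSet ?_
  intro x hx y _ hxy
  exact csSup_le_csSup ⟨y, fun z hz => hz.2⟩ hx.1
    (inter_subset_inter_right _ (Iic_subset_Iic.2 hxy))

theorem lastPoint_mem {𝕋 : Set ℝ} (h𝕋 : IsClosed 𝕋) {s : ℝ} (hs : s ∈ span 𝕋) :
    lastPoint 𝕋 s ∈ 𝕋 :=
  ((h𝕋.inter isClosed_Iic).csSup_mem hs.1 ⟨s, fun _ hz => hz.2⟩).1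

theorem deltaMeasure_compl {𝕋 : Set ℝ} (h𝕋 : IsClosed 𝕋) : deltaMeasure 𝕋 𝕋ᶜ = 0 := by
  rw [deltaMeasure, Measure.map_apply_of_aemeasurable (aemeasurable_lastPoint 𝕋)
    h𝕋.measurableSet.compl, Measure.restrict_apply' (ordConnected_span 𝕋).measurableSet]
  convert measure_empty (μ := (volume : Measure ℝ))
  ext s
  simp only [mem_inter_iff, mem_preimage, mem_compl_iff, mem_empty_iff_false, iff_false, not_and]
  exact fun h hs => h (lastPoint_mem h𝕋 hs)

theorem deltaMeasure_Ico {𝕋 : Set ℝ} {a b : ℝ} (ha : a ∈ 𝕋) (hb : b ∈ 𝕋) :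
    deltaMeasure 𝕋 (Ico a b) = ENNReal.ofReal (b - a) := by
  rw [deltaMeasure, Measure.map_apply_of_aemeasurable (aemeasurable_lastPoint 𝕋)
    measurableSet_Ico, Measure.restrict_apply' (ordConnected_span 𝕋).measurableSet,
    ← Real.volume_Ico]
  congr 1
  ext s
  have bdd : BddAbove (𝕋 ∩ Iic s) := ⟨s, fun _ hz => hz.2⟩
  constructor
  · rintro ⟨⟨h1, h2⟩, hs⟩
    refine ⟨le_trans h1 (csSup_le hs.1 fun _ hz => hz.2), ?_⟩
    by_contra hbs
    exact absurd (le_csSup bdd ⟨hb, not_lt.1 hbs⟩) (not_le.2 h2)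
  · rintro ⟨h1, h2⟩
    exact ⟨⟨le_csSup bdd ⟨ha, h1⟩, lt_of_le_of_lt (csSup_le ⟨a, ha, h1⟩ fun _ hz => hz.2) h2⟩,
      ⟨a, ha, h1⟩, ⟨b, hb, h2⟩⟩

end

end TimeScale

/-! The operator `K` is the fractional integral `I^{2α}` applied to the source term, and it is a
contraction in the sup norm on `C([0,T]_𝕋)`.

The estimate on a general time scale comes from one observation: on `[a, b)` with endpoints in `𝕋`,
the delta measure is the image of Lebesgue measure under `lastPoint`, which moves points to the
left. Delta integrals of nondecreasing functions are therefore at most the Lebesgue ones. For order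
`β ≤ 1` the Abel kernel is nondecreasing, so `|I^β g| ≤ M (t - a)^β / Γ(β + 1)` as on the real line
(`abs_fracIntegral_le`). The difference of two kernels is also monotone, which gives Hölder
continuity (`abs_fracIntegral_sub_le`). Combined with the Lipschitz bound for `x / X²`
(`abs_div_sq_sub_div_sq_le`), the contraction factor is `λ` times the bracket in the hypothesis.

If `[0,T] ⊆ 𝕋`, the delta measure on `[0,T)` is Lebesgue measure and the delta derivative on `(0,T)`
is the usual one. The Beta integral gives `I^p I^q = I^{p+q}`, from which a continuous `v` satisfies
`D^β v = g` on the open interval exactly when `v = I^β g`. The two forms of the problem then have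
the same solutions. -/

namespace TimeScale

/-! ### The delta measure as an image of Lebesgue measure -/

theorem preimage_lastPoint_Ico {𝕋 : Set ℝ} {a b : ℝ} (ha : a ∈ 𝕋) (hb : b ∈ 𝕋) :
    lastPoint 𝕋 ⁻¹' Ico a b ∩ span 𝕋 = Ico a b := by
  ext s
  have bdd : BddAbove (𝕋 ∩ Iic s) := ⟨s, fun _ hz => hz.2⟩
  constructor
  -- Membership in `span 𝕋` excludes the `s` with no point of `𝕋` before them, where `sSup ∅ = 0` is
  -- a junk value.
  · rintro ⟨⟨h1, h2⟩, hs⟩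
    refine ⟨le_trans h1 (csSup_le hs.1 fun _ hz => hz.2), ?_⟩
    by_contra hbs
    exact absurd (le_csSup bdd ⟨hb, not_lt.1 hbs⟩) (not_le.2 h2)
  · rintro ⟨h1, h2⟩
    exact ⟨⟨le_csSup bdd ⟨ha, h1⟩, lt_of_le_of_lt (csSup_le ⟨a, ha, h1⟩ fun _ hz => hz.2) h2⟩,
      ⟨a, ha, h1⟩, ⟨b, hb, h2⟩⟩

theorem lastPoint_mem_Ico {𝕋 : Set ℝ} {a b s : ℝ} (ha : a ∈ 𝕋) (hb : b ∈ 𝕋) (hs : s ∈ Ico a b) :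
    lastPoint 𝕋 s ∈ Ico a b := by
  rw [← preimage_lastPoint_Ico ha hb] at hs
  exact hs.1

theorem lastPoint_le {𝕋 : Set ℝ} {a s : ℝ} (ha : a ∈ 𝕋) (hs : a ≤ s) : lastPoint 𝕋 s ≤ s :=
  csSup_le ⟨a, ha, hs⟩ fun _ hz => hz.2

theorem lastPoint_eq_self {𝕋 : Set ℝ} {s : ℝ} (hs : s ∈ 𝕋) : lastPoint 𝕋 s = s :=
  le_antisymm (lastPoint_le hs le_rfl) (le_csSup ⟨s, fun _ hz => hz.2⟩ ⟨hs, mem_Iic.2 le_rfl⟩)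

theorem aemeasurable_lastPoint_Ico {𝕋 : Set ℝ} {a b : ℝ} (ha : a ∈ 𝕋) (hb : b ∈ 𝕋) :
    AEMeasurable (lastPoint 𝕋) (volume.restrict (Ico a b)) :=
  (aemeasurable_lastPoint 𝕋).mono_set
    (preimage_lastPoint_Ico ha hb ▸ inter_subset_right)

/-- Every comparison of delta integrals with Lebesgue integrals goes through this change of
variables. -/
theorem deltaMeasure_restrict_Ico {𝕋 : Set ℝ} {a b : ℝ} (ha : a ∈ 𝕋) (hb : b ∈ 𝕋) :
    (deltaMeasure 𝕋).restrict (Ico a b) = (volume.restrict (Ico a b)).map (lastPoint 𝕋) := by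
  rw [deltaMeasure, Measure.restrict_map_of_aemeasurable (aemeasurable_lastPoint 𝕋)
    measurableSet_Ico, Measure.restrict_restrict' (ordConnected_span 𝕋).measurableSet,
    preimage_lastPoint_Ico ha hb]

/-- Where there are no gaps, `lastPoint` is the identity. -/
theorem deltaMeasure_restrict_Ico_of_subset {𝕋 : Set ℝ} {a b : ℝ} (hab : a ≤ b)
    (h : Icc a b ⊆ 𝕋) : (deltaMeasure 𝕋).restrict (Ico a b) = volume.restrict (Ico a b) := by
  rw [deltaMeasure_restrict_Ico (h (left_mem_Icc.2 hab)) (h (right_mem_Icc.2 hab))]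
  conv_rhs => rw [← Measure.map_id (μ := volume.restrict (Ico a b))]
  refine Measure.map_congr ?_
  filter_upwards [ae_restrict_mem measurableSet_Ico] with s hs
  exact lastPoint_eq_self (h ⟨hs.1, hs.2.le⟩)

theorem ae_mem_deltaMeasure_restrict {𝕋 : Set ℝ} (h𝕋 : IsClosed 𝕋) (a b : ℝ) :
    ∀ᵐ s ∂(deltaMeasure 𝕋).restrict (Ico a b), s ∈ 𝕋 ∩ Ico a b := by
  have h : ∀ᵐ s ∂(deltaMeasure 𝕋), s ∈ 𝕋 := deltaMeasure_compl h𝕋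
  filter_upwards [ae_restrict_of_ae h, ae_restrict_mem measurableSet_Ico] with s h1 h2
  exact ⟨h1, h2⟩

theorem isFiniteMeasure_deltaMeasure_restrict {𝕋 : Set ℝ} {a b : ℝ} (ha : a ∈ 𝕋) (hb : b ∈ 𝕋) :
    IsFiniteMeasure ((deltaMeasure 𝕋).restrict (Ico a b)) := by
  refine ⟨?_⟩
  rw [Measure.restrict_apply_univ, deltaMeasure_Ico ha hb]
  exact ENNReal.ofReal_lt_top

theorem aestronglyMeasurable_of_continuousOn {𝕋 : Set ℝ} (h𝕋 : IsClosed 𝕋) {a b t : ℝ}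
    (htb : t ≤ b) {g : ℝ → ℝ} (hg : ContinuousOn g (𝕋 ∩ Icc a b)) :
    AEStronglyMeasurable g ((deltaMeasure 𝕋).restrict (Ico a t)) := by
  have hS : MeasurableSet (𝕋 ∩ Icc a b) := (h𝕋.inter isClosed_Icc).measurableSet
  have h1 := hg.aestronglyMeasurable (μ := (deltaMeasure 𝕋).restrict (Ico a t)) hS
  rwa [Measure.restrict_eq_self_of_ae_mem] at h1
  filter_upwards [ae_mem_deltaMeasure_restrict h𝕋 a t] with s hs
  exact ⟨hs.1, hs.2.1, (hs.2.2.le).trans htb⟩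

theorem deltaIntegral_congr {𝕋 : Set ℝ} (h𝕋 : IsClosed 𝕋) {a b : ℝ} {g h : ℝ → ℝ}
    (hgh : EqOn g h (𝕋 ∩ Ico a b)) : deltaIntegral 𝕋 a b g = deltaIntegral 𝕋 a b h := by
  refine integral_congr_ae ?_
  filter_upwards [ae_mem_deltaMeasure_restrict h𝕋 a b] with s hs using hgh hs

/-- A monotone function which is Lebesgue integrable on `[a, b)` is delta integrable. -/
theorem integrableOn_of_monotoneOn {𝕋 : Set ℝ} {a b : ℝ} (ha : a ∈ 𝕋) (hb : b ∈ 𝕋)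
    {g : ℝ → ℝ} (hg : MonotoneOn g (Ico a b)) (hg0 : ∀ s ∈ Ico a b, 0 ≤ g s)
    (hint : IntegrableOn g (Ico a b)) : IntegrableOn g (Ico a b) (deltaMeasure 𝕋) := by
  have hm : AEMeasurable g ((deltaMeasure 𝕋).restrict (Ico a b)) :=
    aemeasurable_restrict_of_monotoneOn measurableSet_Ico hg
  rw [IntegrableOn, deltaMeasure_restrict_Ico ha hb]
  rw [deltaMeasure_restrict_Ico ha hb] at hm
  have hl := aemeasurable_lastPoint_Ico ha hb
  rw [integrable_map_measure hm.aestronglyMeasurable hl]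
  -- After the change of variables the integrand is `g (lastPoint 𝕋 s)`. As `lastPoint 𝕋 s ≤ s` and
  -- `g` is nondecreasing, `g` itself dominates it.
  refine Integrable.mono' hint (hm.comp_aemeasurable hl).aestronglyMeasurable ?_
  filter_upwards [ae_restrict_mem measurableSet_Ico] with s hs
  have h1 := lastPoint_mem_Ico ha hb hs
  rw [Function.comp_apply, Real.norm_of_nonneg (hg0 _ h1)]
  exact hg h1 hs (lastPoint_le ha hs.1)

/-- The delta integral of a monotone function is at most its Lebesgue integral. -/
theorem setIntegral_le_of_monotoneOn {𝕋 : Set ℝ} {a b : ℝ} (ha : a ∈ 𝕋) (hb : b ∈ 𝕋)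
    {g : ℝ → ℝ} (hg : MonotoneOn g (Ico a b)) (hg0 : ∀ s ∈ Ico a b, 0 ≤ g s)
    (hint : IntegrableOn g (Ico a b)) :
    ∫ s in Ico a b, g s ∂(deltaMeasure 𝕋) ≤ ∫ s in Ico a b, g s := by
  have hI := integrableOn_of_monotoneOn ha hb hg hg0 hint
  have hl := aemeasurable_lastPoint_Ico ha hb
  rw [IntegrableOn, deltaMeasure_restrict_Ico ha hb] at hI
  rw [deltaMeasure_restrict_Ico ha hb, integral_map hl hI.aestronglyMeasurable]
  refine integral_mono_ae ((integrable_map_measure hI.aestronglyMeasurable hl).1 hI) hint ?_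
  filter_upwards [ae_restrict_mem measurableSet_Ico] with s hs
  exact hg (lastPoint_mem_Ico ha hb hs) hs (lastPoint_le ha hs.1)

/-! ### Abel kernels: monotonicity and Lebesgue integrals -/

theorem monotoneOn_kernel {β : ℝ} (hβ : β ≤ 1) (a t : ℝ) :
    MonotoneOn (fun s => (t - s) ^ (β - 1)) (Ico a t) := by
  intro x _ y hy hxy
  exact Real.rpow_le_rpow_of_nonpos (sub_pos.2 hy.2) (by linarith) (by linarith)

/-- The function factors as `x ^ p * (1 - (1 + δ / x) ^ p)`, a product of two nonnegative
nonincreasing factors. It makes the difference of two Abel kernels monotone, as the Hölder estimate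
requires. -/
theorem antitoneOn_rpow_sub_rpow {p δ : ℝ} (hp : p ≤ 0) (hδ : 0 ≤ δ) :
    AntitoneOn (fun x : ℝ => x ^ p - (x + δ) ^ p) (Ioi 0) := by
  have key : ∀ x ∈ Ioi (0 : ℝ), x ^ p - (x + δ) ^ p = x ^ p * (1 - (1 + δ / x) ^ p) := by
    intro x (hx : 0 < x)
    rw [mul_sub, mul_one, ← Real.mul_rpow hx.le (by positivity)]
    congr 2
    field_simp
  intro x hx y hy hxy
  have hx' : 0 < x := hx
  have hy' : 0 < y := hy
  simp only [key x hx, key y hy]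
  refine mul_le_mul (Real.rpow_le_rpow_of_nonpos hx' hxy hp) ?_ ?_ (by positivity)
  · have : (1 + δ / x) ^ p ≤ (1 + δ / y) ^ p :=
      Real.rpow_le_rpow_of_nonpos (by positivity) (by gcongr) hp
    linarith
  · have : (1 + δ / y) ^ p ≤ 1 :=
      Real.rpow_le_one_of_one_le_of_nonpos (by linarith [div_nonneg hδ hy'.le]) hp
    linarith

theorem intervalIntegrable_kernel {β : ℝ} (hβ : 0 < β) (t a b : ℝ) :
    IntervalIntegrable (fun s => (t - s) ^ (β - 1)) volume a b := by
  have := (intervalIntegral.intervalIntegrable_rpow' (a := t - a) (b := t - b)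
    (show -1 < β - 1 by linarith)).comp_sub_left t
  simpa using this

theorem integrableOn_kernel {β : ℝ} (hβ : 0 < β) (t : ℝ) {a b : ℝ} (hab : a ≤ b) :
    IntegrableOn (fun s => (t - s) ^ (β - 1)) (Ico a b) :=
  ((intervalIntegrable_iff_integrableOn_Ico_of_le hab).1 (intervalIntegrable_kernel hβ t a b))

theorem setIntegral_kernel {β : ℝ} (hβ : 0 < β) (t : ℝ) {a b : ℝ} (hab : a ≤ b) :
    ∫ s in Ico a b, (t - s) ^ (β - 1) = ((t - a) ^ β - (t - b) ^ β) / β := by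
  rw [integral_Ico_eq_integral_Ioc, ← intervalIntegral.integral_of_le hab,
    intervalIntegral.integral_comp_sub_left (fun x => x ^ (β - 1)),
    integral_rpow (Or.inl (by linarith)), sub_add_cancel]

/-! ### Bounds and continuity of fractional integrals -/

section FracIntegral

variable {𝕋 : Set ℝ} {a t t' β M : ℝ} {g h : ℝ → ℝ}

theorem integrableOn_kernel_deltaMeasure (ha : a ∈ 𝕋) (ht : t ∈ 𝕋) (hat : a ≤ t) (hβ : 0 < β)
    (hβ1 : β ≤ 1) : IntegrableOn (fun s => (t - s) ^ (β - 1)) (Ico a t) (deltaMeasure 𝕋) :=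
  integrableOn_of_monotoneOn ha ht (monotoneOn_kernel hβ1 a t)
    (fun _ hs => Real.rpow_nonneg (sub_nonneg.2 hs.2.le) _) (integrableOn_kernel hβ t hat)

theorem setIntegral_kernel_deltaMeasure_le (ha : a ∈ 𝕋) (ht : t ∈ 𝕋) (hat : a ≤ t) (hβ : 0 < β)
    (hβ1 : β ≤ 1) :
    ∫ s in Ico a t, (t - s) ^ (β - 1) ∂(deltaMeasure 𝕋) ≤ (t - a) ^ β / β := by
  refine (setIntegral_le_of_monotoneOn ha ht (monotoneOn_kernel hβ1 a t)
    (fun s hs => Real.rpow_nonneg (sub_nonneg.2 hs.2.le) _) (integrableOn_kernel hβ t hat)).trans ?_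
  rw [setIntegral_kernel hβ t hat, sub_self, Real.zero_rpow hβ.ne', sub_zero]

theorem integrableOn_kernel_mul (h𝕋 : IsClosed 𝕋) (ha : a ∈ 𝕋) (ht : t ∈ 𝕋) (hat : a ≤ t)
    (hβ : 0 < β) (hβ1 : β ≤ 1)
    (hg : AEStronglyMeasurable g ((deltaMeasure 𝕋).restrict (Ico a t)))
    (hM : ∀ s ∈ 𝕋 ∩ Ico a t, |g s| ≤ M) :
    IntegrableOn (fun s => (t - s) ^ (β - 1) * g s) (Ico a t) (deltaMeasure 𝕋) := by
  refine (integrableOn_kernel_deltaMeasure ha ht hat hβ hβ1).mul_bdd (c := M) hg ?_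
  filter_upwards [ae_mem_deltaMeasure_restrict h𝕋 a t] with s hs using hM s hs

theorem fracIntegral_eq (𝕋 : Set ℝ) (a β : ℝ) (g : ℝ → ℝ) (t : ℝ) :
    fracIntegral 𝕋 a β g t =
      (∫ s in Ico a t, (t - s) ^ (β - 1) * g s ∂(deltaMeasure 𝕋)) / Real.Gamma β := by
  rw [fracIntegral, deltaIntegral, ← integral_div]
  refine integral_congr_ae (Eventually.of_forall fun _ => ?_)
  simp only
  ring

theorem fracIntegral_congr (h𝕋 : IsClosed 𝕋) (hgh : EqOn g h (𝕋 ∩ Ico a t)) :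
    fracIntegral 𝕋 a β g t = fracIntegral 𝕋 a β h t :=
  deltaIntegral_congr h𝕋 fun _ hs => by simp only [hgh hs]

theorem fracIntegral_nonneg (h𝕋 : IsClosed 𝕋) (hβ : 0 < β) (hg : ∀ s ∈ 𝕋 ∩ Ico a t, 0 ≤ g s) :
    0 ≤ fracIntegral 𝕋 a β g t := by
  refine integral_nonneg_of_ae ?_
  filter_upwards [ae_mem_deltaMeasure_restrict h𝕋 a t] with s hs
  exact mul_nonneg (div_nonneg (Real.rpow_nonneg (sub_nonneg.2 hs.2.2.le) _)
    (Real.Gamma_pos_of_pos hβ).le) (hg s hs)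

/-- Gaps can only decrease the integral of the kernel, so the real-line constant survives; `β Γ(β) =
Γ(β + 1)` absorbs the `1 / β`. -/
theorem abs_fracIntegral_le (h𝕋 : IsClosed 𝕋) (ha : a ∈ 𝕋) (ht : t ∈ 𝕋) (hat : a ≤ t)
    (hβ : 0 < β) (hβ1 : β ≤ 1) (hM0 : 0 ≤ M) (hM : ∀ s ∈ 𝕋 ∩ Ico a t, |g s| ≤ M) :
    |fracIntegral 𝕋 a β g t| ≤ M * (t - a) ^ β / Real.Gamma (β + 1) := by
  have hΓ := Real.Gamma_pos_of_pos hβ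
  rw [fracIntegral_eq, abs_div, abs_of_pos hΓ, Real.Gamma_add_one hβ.ne', ← div_div]
  gcongr
  calc |∫ s in Ico a t, (t - s) ^ (β - 1) * g s ∂(deltaMeasure 𝕋)|
      ≤ ∫ s in Ico a t, M * (t - s) ^ (β - 1) ∂(deltaMeasure 𝕋) := by
        refine norm_integral_le_of_norm_le (f := fun s => (t - s) ^ (β - 1) * g s)
          ((integrableOn_kernel_deltaMeasure ha ht hat hβ hβ1).const_mul M) ?_
        filter_upwards [ae_mem_deltaMeasure_restrict h𝕋 a t] with s hs
        have h0 : 0 ≤ (t - s) ^ (β - 1) := Real.rpow_nonneg (sub_nonneg.2 hs.2.2.le) _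
        rw [norm_mul, Real.norm_of_nonneg h0, mul_comm]
        exact mul_le_mul_of_nonneg_right (hM s hs) h0
    _ ≤ M * (t - a) ^ β / β := by
        rw [integral_const_mul, mul_div_assoc]
        exact mul_le_mul_of_nonneg_left (setIntegral_kernel_deltaMeasure_le ha ht hat hβ hβ1) hM0

theorem fracIntegral_sub (h𝕋 : IsClosed 𝕋) (ha : a ∈ 𝕋) (ht : t ∈ 𝕋) (hat : a ≤ t)
    (hβ : 0 < β) (hβ1 : β ≤ 1)
    (hg : AEStronglyMeasurable g ((deltaMeasure 𝕋).restrict (Ico a t)))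
    (hgM : ∀ s ∈ 𝕋 ∩ Ico a t, |g s| ≤ M)
    (hh : AEStronglyMeasurable h ((deltaMeasure 𝕋).restrict (Ico a t)))
    (hhM : ∀ s ∈ 𝕋 ∩ Ico a t, |h s| ≤ M) :
    fracIntegral 𝕋 a β g t - fracIntegral 𝕋 a β h t = fracIntegral 𝕋 a β (fun s => g s - h s) t := by
  rw [fracIntegral_eq, fracIntegral_eq, fracIntegral_eq, ← sub_div, ← integral_sub
    (integrableOn_kernel_mul h𝕋 ha ht hat hβ hβ1 hg hgM)
    (integrableOn_kernel_mul h𝕋 ha ht hat hβ hβ1 hh hhM)]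
  simp only [mul_sub]

/-- The fractional integral of order `β ≤ 1` of a bounded function is Hölder continuous with
exponent `β`. -/
theorem abs_fracIntegral_sub_le (h𝕋 : IsClosed 𝕋) (ha : a ∈ 𝕋) (ht : t ∈ 𝕋) (ht' : t' ∈ 𝕋)
    (hat : a ≤ t) (htt' : t ≤ t') (hβ : 0 < β) (hβ1 : β ≤ 1) (hM0 : 0 ≤ M)
    (hg : AEStronglyMeasurable g ((deltaMeasure 𝕋).restrict (Ico a t')))
    (hM : ∀ s ∈ 𝕋 ∩ Ico a t', |g s| ≤ M) :
    |fracIntegral 𝕋 a β g t' - fracIntegral 𝕋 a β g t| ≤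
      2 * M * (t' - t) ^ β / Real.Gamma (β + 1) := by
  have hsub : Ico a t ⊆ Ico a t' := Ico_subset_Ico_right htt'
  have hsub' : Ico t t' ⊆ Ico a t' := Ico_subset_Ico_left hat
  have hg1 : AEStronglyMeasurable g ((deltaMeasure 𝕋).restrict (Ico a t)) :=
    hg.mono_measure (Measure.restrict_mono_set _ hsub)
  have hI' := integrableOn_kernel_mul h𝕋 ha ht' (hat.trans htt') hβ hβ1 hg hM
  have hI := integrableOn_kernel_mul h𝕋 ha ht hat hβ hβ1 hg1 fun s hs => hM s ⟨hs.1, hsub hs.2⟩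
  have hΓ := Real.Gamma_pos_of_pos hβ
  -- The increment consists of the new piece over `[t, t')` and the change of kernel over `[a, t)`.
  -- Each is at most `M (t' - t)^β / β`, whence the factor 2.
  have hsplit : ∫ s in Ico a t', (t' - s) ^ (β - 1) * g s ∂(deltaMeasure 𝕋) =
      (∫ s in Ico a t, (t' - s) ^ (β - 1) * g s ∂(deltaMeasure 𝕋)) +
        ∫ s in Ico t t', (t' - s) ^ (β - 1) * g s ∂(deltaMeasure 𝕋) := by
    rw [← setIntegral_union (Ico_disjoint_Ico_same) measurableSet_Ico
      (hI'.mono_set hsub) (hI'.mono_set hsub'), Ico_union_Ico_eq_Ico hat htt']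
  -- The substitution `x = t - s` reverses order, so the antitone difference in `x` is monotone in
  -- `s`.
  have hmono : MonotoneOn (fun s => (t - s) ^ (β - 1) - (t' - s) ^ (β - 1)) (Ico a t) := by
    intro x hx y hy hxy
    have := antitoneOn_rpow_sub_rpow (p := β - 1) (δ := t' - t) (by linarith) (by linarith)
      (show t - y ∈ Ioi 0 from sub_pos.2 hy.2) (show t - x ∈ Ioi 0 from sub_pos.2 hx.2)
      (by linarith)
    simp only at this ⊢
    convert this using 3 <;> ring
  have hpos : ∀ s ∈ Ico a t, 0 ≤ (t - s) ^ (β - 1) - (t' - s) ^ (β - 1) := fun s hs =>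
    sub_nonneg.2 (Real.rpow_le_rpow_of_nonpos (sub_pos.2 hs.2) (by linarith) (by linarith))
  have hint : IntegrableOn (fun s => (t - s) ^ (β - 1) - (t' - s) ^ (β - 1)) (Ico a t) :=
    (integrableOn_kernel hβ t hat).sub (integrableOn_kernel hβ t' hat)
  have h1 : |∫ s in Ico t t', (t' - s) ^ (β - 1) * g s ∂(deltaMeasure 𝕋)| ≤
      M * ((t' - t) ^ β / β) := by
    refine (norm_integral_le_of_norm_le (f := fun s => (t' - s) ^ (β - 1) * g s)
          ((integrableOn_kernel_deltaMeasure ht ht' htt' hβ hβ1).const_mul M) ?_).trans ?_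
    · filter_upwards [ae_mem_deltaMeasure_restrict h𝕋 t t'] with s hs
      have h0 : 0 ≤ (t' - s) ^ (β - 1) := Real.rpow_nonneg (sub_nonneg.2 hs.2.2.le) _
      rw [norm_mul, Real.norm_of_nonneg h0, mul_comm]
      exact mul_le_mul_of_nonneg_right (hM s ⟨hs.1, hsub' hs.2⟩) h0
    · rw [integral_const_mul]
      exact mul_le_mul_of_nonneg_left (setIntegral_kernel_deltaMeasure_le ht ht' htt' hβ hβ1) hM0
  have h2 : |(∫ s in Ico a t, (t - s) ^ (β - 1) * g s ∂(deltaMeasure 𝕋)) -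
      ∫ s in Ico a t, (t' - s) ^ (β - 1) * g s ∂(deltaMeasure 𝕋)| ≤
      M * ((t' - t) ^ β / β) := by
    rw [← integral_sub hI (hI'.mono_set hsub)]
    refine (norm_integral_le_of_norm_le
      (f := fun s => (t - s) ^ (β - 1) * g s - (t' - s) ^ (β - 1) * g s)
      ((integrableOn_of_monotoneOn ha ht hmono hpos hint).const_mul M) ?_).trans ?_
    · filter_upwards [ae_mem_deltaMeasure_restrict h𝕋 a t] with s hs
      rw [← sub_mul, norm_mul, Real.norm_of_nonneg (hpos s hs.2), mul_comm]
      exact mul_le_mul_of_nonneg_right (hM s ⟨hs.1, hsub hs.2⟩) (hpos s hs.2)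
    · rw [integral_const_mul]
      refine mul_le_mul_of_nonneg_left
        ((setIntegral_le_of_monotoneOn ha ht hmono hpos hint).trans ?_) hM0
      rw [integral_sub (integrableOn_kernel hβ t hat) (integrableOn_kernel hβ t' hat),
        setIntegral_kernel hβ t hat, setIntegral_kernel hβ t' hat, sub_self,
        Real.zero_rpow hβ.ne', ← sub_div]
      -- The Lebesgue integral equals `((t - a)^β - (t' - a)^β + (t' - t)^β) / β`, and the first two
      -- terms together are nonpositive.
      have : (t - a) ^ β ≤ (t' - a) ^ β :=
        Real.rpow_le_rpow (sub_nonneg.2 hat) (by linarith) hβ.le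
      gcongr
      linarith
  rw [fracIntegral_eq, fracIntegral_eq, ← sub_div, abs_div, abs_of_pos hΓ,
    Real.Gamma_add_one hβ.ne', ← div_div, hsplit]
  gcongr
  have h3 : 2 * M * (t' - t) ^ β / β = M * ((t' - t) ^ β / β) + M * ((t' - t) ^ β / β) := by ring
  rw [h3]
  rw [abs_le] at *
  constructor <;> linarith [h1.1, h1.2, h2.1, h2.2]

theorem continuousOn_fracIntegral (h𝕋 : IsClosed 𝕋) {b : ℝ} (ha : a ∈ 𝕋) (hβ : 0 < β)
    (hβ1 : β ≤ 1) (hg : ContinuousOn g (𝕋 ∩ Icc a b)) :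
    ContinuousOn (fracIntegral 𝕋 a β g) (𝕋 ∩ Icc a b) := by
  obtain ⟨M, hM⟩ := (isCompact_Icc.inter_left h𝕋).exists_bound_of_continuousOn hg
  simp only [Real.norm_eq_abs] at hM
  have key : ∀ x ∈ 𝕋 ∩ Icc a b, ∀ y ∈ 𝕋 ∩ Icc a b, x ≤ y →
      |fracIntegral 𝕋 a β g y - fracIntegral 𝕋 a β g x| ≤
        2 * M * |y - x| ^ β / Real.Gamma (β + 1) := by
    intro x hx y hy hxy
    rw [abs_of_nonneg (sub_nonneg.2 hxy)]
    exact abs_fracIntegral_sub_le h𝕋 ha hx.1 hy.1 hx.2.1 hxy hβ hβ1 ((abs_nonneg _).trans (hM x hx))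
      (aestronglyMeasurable_of_continuousOn h𝕋 hy.2.2 hg)
      fun s hs => hM s ⟨hs.1, hs.2.1, hs.2.2.le.trans hy.2.2⟩
  intro x hx
  have hlim : Tendsto (fun y => 2 * M * |y - x| ^ β / Real.Gamma (β + 1)) (𝓝[𝕋 ∩ Icc a b] x)
      (𝓝 0) := by
    have hc : Continuous fun y : ℝ => 2 * M * |y - x| ^ β / Real.Gamma (β + 1) :=
      (continuous_const.mul ((continuous_abs.comp (continuous_id.sub continuous_const)).rpow_const
        fun _ => Or.inr hβ.le)).div_const _
    have := (hc.tendsto x).mono_left (nhdsWithin_le_nhds (s := 𝕋 ∩ Icc a b))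
    simpa [Real.zero_rpow hβ.ne'] using this
  rw [ContinuousWithinAt, tendsto_iff_dist_tendsto_zero]
  refine squeeze_zero' (Eventually.of_forall fun _ => dist_nonneg) ?_ hlim
  filter_upwards [self_mem_nhdsWithin] with y hy
  rw [Real.dist_eq]
  rcases le_total x y with h | h
  · exact key x hx y hy h
  · rw [abs_sub_comm, abs_sub_comm y]
    exact key y hy x hx h

end FracIntegral

/-! ### The Beta integral and composition of Abel kernels -/

/-- The substitution `x = t - s` gives a scaled Beta integral on `[0, t - r]`; the complex
evaluation is brought back to the reals by injectivity of the coercion. -/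
theorem setIntegral_beta {p q r t : ℝ} (hp : 0 < p) (hq : 0 < q) (hrt : r < t) :
    ∫ s in Ioo r t, (t - s) ^ (p - 1) * (s - r) ^ (q - 1) =
      (t - r) ^ (p + q - 1) * (Real.Gamma p * Real.Gamma q / Real.Gamma (p + q)) := by
  have h0 : 0 < t - r := sub_pos.2 hrt
  have h1 : ∫ s in Ioo r t, (t - s) ^ (p - 1) * (s - r) ^ (q - 1) =
      ∫ x in (0 : ℝ)..(t - r), x ^ (p - 1) * ((t - r) - x) ^ (q - 1) := by
    rw [← integral_Ioc_eq_integral_Ioo, ← intervalIntegral.integral_of_le hrt.le]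
    have := intervalIntegral.integral_comp_sub_left
      (fun x : ℝ => x ^ (p - 1) * ((t - r) - x) ^ (q - 1)) (a := r) (b := t) t
    rw [sub_self] at this
    rw [← this]
    congr 1 with s
    congr 2
    ring
  have h2 := Complex.betaIntegral_scaled p q h0
  have h3 : ∫ x in (0 : ℝ)..(t - r),
      (x : ℂ) ^ ((p : ℂ) - 1) * (((t - r : ℝ) : ℂ) - x) ^ ((q : ℂ) - 1)
      = ((∫ x in (0 : ℝ)..(t - r), x ^ (p - 1) * ((t - r) - x) ^ (q - 1) : ℝ) : ℂ) := by
    rw [← intervalIntegral.integral_ofReal]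
    refine intervalIntegral.integral_congr fun x hx => ?_
    rw [uIcc_of_le h0.le] at hx
    rw [Complex.ofReal_mul, Complex.ofReal_cpow hx.1, Complex.ofReal_cpow (sub_nonneg.2 hx.2)]
    push_cast
    rfl
  have h4 : Complex.betaIntegral p q =
      ((Real.Gamma p * Real.Gamma q / Real.Gamma (p + q) : ℝ) : ℂ) := by
    have := Complex.Gamma_mul_Gamma_eq_betaIntegral (s := p) (t := q) (by simpa) (by simpa)
    rw [← Complex.ofReal_add, Complex.Gamma_ofReal, Complex.Gamma_ofReal, Complex.Gamma_ofReal]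
      at this
    have hne : (Real.Gamma (p + q) : ℂ) ≠ 0 :=
      Complex.ofReal_ne_zero.2 (Real.Gamma_pos_of_pos (add_pos hp hq)).ne'
    push_cast
    rw [this, mul_div_cancel_left₀ _ hne]
  rw [h3, h4] at h2
  rw [h1]
  apply Complex.ofReal_injective
  rw [h2, Complex.ofReal_mul, Complex.ofReal_cpow h0.le]
  push_cast
  rfl

/-- A non-integrable function has Bochner integral 0, whereas the value just computed is positive.
-/
theorem integrableOn_beta {p q r t : ℝ} (hp : 0 < p) (hq : 0 < q) (hrt : r < t) :
    IntegrableOn (fun s => (t - s) ^ (p - 1) * (s - r) ^ (q - 1)) (Ioo r t) := by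
  by_contra h
  have h1 := setIntegral_beta hp hq hrt
  rw [integral_undef h] at h1
  have h2 := Real.rpow_pos_of_pos (sub_pos.2 hrt) (p + q - 1)
  have h3 := Real.Gamma_pos_of_pos hp
  have h4 := Real.Gamma_pos_of_pos hq
  have h5 := Real.Gamma_pos_of_pos (add_pos hp hq)
  have : 0 < (t - r) ^ (p + q - 1) * (Real.Gamma p * Real.Gamma q / Real.Gamma (p + q)) := by
    positivity
  exact this.ne h1

/-- Interchange of the order of integration in the composition of two Abel kernels. -/
theorem setIntegral_kernel_setIntegral_kernel {p q a t : ℝ} (hp : 0 < p) (hq : 0 < q)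
    (hat : a ≤ t) {g : ℝ → ℝ} (hg : ContinuousOn g (Icc a t)) :
    ∫ s in Ico a t, (t - s) ^ (p - 1) * ∫ r in Ico a s, (s - r) ^ (q - 1) * g r =
      Real.Gamma p * Real.Gamma q / Real.Gamma (p + q) *
        ∫ r in Ico a t, (t - r) ^ (p + q - 1) * g r := by
  set B := Real.Gamma p * Real.Gamma q / Real.Gamma (p + q) with hB
  set μ : Measure ℝ := volume.restrict (Ico a t) with hμ
  -- The indicator of `r < s` turns the triangle into the square `[a, t)²`, where Fubini applies.
  -- For fixed `r` the integral in `s` is a Beta integral.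
  set k : ℝ → ℝ → ℝ := fun s r => (Ioi r).indicator
    (fun s => (t - s) ^ (p - 1) * (s - r) ^ (q - 1)) s with hk
  obtain ⟨M, hM⟩ := isCompact_Icc.exists_bound_of_continuousOn hg
  have hgm : AEStronglyMeasurable g μ :=
    (hg.mono Ico_subset_Icc_self).aestronglyMeasurable measurableSet_Ico
  have hkr : ∀ r ∈ Ico a t, Integrable (fun s => k s r) μ ∧
      ∫ s, k s r ∂μ = (t - r) ^ (p + q - 1) * B := by
    intro r hr
    have hset : Ioi r ∩ Ico a t = Ioo r t := by
      ext s
      exact ⟨fun h => ⟨h.1, h.2.2⟩, fun h => ⟨h.1, hr.1.trans h.1.le, h.2⟩⟩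
    constructor
    · rw [hk, integrable_indicator_iff measurableSet_Ioi, IntegrableOn, hμ,
        Measure.restrict_restrict measurableSet_Ioi, hset]
      exact integrableOn_beta hp hq hr.2
    · rw [hk, integral_indicator measurableSet_Ioi, hμ,
        Measure.restrict_restrict measurableSet_Ioi, hset]
      exact setIntegral_beta hp hq hr.2
  have hk0 : ∀ s ∈ Ico a t, ∀ r, 0 ≤ k s r := by
    intro s hs r
    refine indicator_apply_nonneg fun h => ?_
    exact mul_nonneg (Real.rpow_nonneg (sub_nonneg.2 hs.2.le) _)
      (Real.rpow_nonneg (sub_nonneg.2 (le_of_lt h)) _)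
  have hkm : Measurable (Function.uncurry k) := by
    have : Function.uncurry k = {z : ℝ × ℝ | z.2 < z.1}.indicator
        (fun z => (t - z.1) ^ (p - 1) * (z.1 - z.2) ^ (q - 1)) := by
      ext z
      rfl
    rw [this]
    exact Measurable.indicator (by fun_prop) (measurableSet_lt measurable_snd measurable_fst)
  have hint : Integrable (Function.uncurry fun s r => k s r * g r) (μ.prod μ) := by
    have hm : AEStronglyMeasurable (Function.uncurry fun s r => k s r * g r) (μ.prod μ) :=
      hkm.aestronglyMeasurable.mul hgm.comp_snd
    -- Slices at fixed `r` are used because their norms have an explicit integral: the kernel of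
    -- order `p + q` times `B * ‖g r‖`, with `g` bounded.
    rw [integrable_prod_iff' hm]
    constructor
    · filter_upwards [ae_restrict_mem measurableSet_Ico] with r hr
      exact (hkr r hr).1.mul_const (g r)
    · have hI : Integrable (fun r => (t - r) ^ (p + q - 1) * B * ‖g r‖) μ := by
        refine ((integrableOn_kernel (add_pos hp hq) t hat).mul_const B).mul_bdd (c := M)
          hgm.norm ?_
        filter_upwards [ae_restrict_mem measurableSet_Ico] with r hr
        simpa using hM r (Ico_subset_Icc_self hr)
      refine hI.congr ?_
      filter_upwards [ae_restrict_mem measurableSet_Ico] with r hr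
      rw [← (hkr r hr).2, ← integral_mul_const]
      refine integral_congr_ae ?_
      filter_upwards [ae_restrict_mem measurableSet_Ico] with s hs
      simp only [Function.uncurry, norm_mul]
      rw [Real.norm_of_nonneg (hk0 s hs r)]
  have hswap := integral_integral_swap hint
  have hL : ∫ s, ∫ r, k s r * g r ∂μ ∂μ =
      ∫ s in Ico a t, (t - s) ^ (p - 1) * ∫ r in Ico a s, (s - r) ^ (q - 1) * g r := by
    refine integral_congr_ae ?_
    filter_upwards [ae_restrict_mem measurableSet_Ico] with s hs
    have hset : Iio s ∩ Ico a t = Ico a s := by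
      ext r
      exact ⟨fun h => ⟨h.2.1, h.1⟩, fun h => ⟨h.2, h.1, h.2.trans hs.2⟩⟩
    have hfun : (fun r => k s r * g r) = (Iio s).indicator
        (fun r => (t - s) ^ (p - 1) * ((s - r) ^ (q - 1) * g r)) := by
      ext r
      by_cases h : r < s
      · simp [hk, h, mul_assoc]
      · simp [hk, h]
    rw [hfun, integral_indicator measurableSet_Iio, hμ,
      Measure.restrict_restrict measurableSet_Iio, hset, integral_const_mul]
  have hR : ∫ r, ∫ s, k s r * g r ∂μ ∂μ = B * ∫ r in Ico a t, (t - r) ^ (p + q - 1) * g r := by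
    rw [← integral_const_mul]
    refine integral_congr_ae ?_
    filter_upwards [ae_restrict_mem measurableSet_Ico] with r hr
    rw [integral_mul_const, (hkr r hr).2]
    ring
  rw [← hL, hswap, hR]

/-! ### Fractional calculus on an interval contained in the time scale -/

section FracIntegral

variable {𝕋 : Set ℝ} {a t T β p q d : ℝ} {g : ℝ → ℝ}

theorem fracIntegral_eq_of_subset (hat : a ≤ t) (h : Icc a t ⊆ 𝕋) (β : ℝ) (g : ℝ → ℝ) :
    fracIntegral 𝕋 a β g t = (∫ s in Ico a t, (t - s) ^ (β - 1) * g s) / Real.Gamma β := by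
  rw [fracIntegral_eq, deltaMeasure_restrict_Ico_of_subset hat h]

/-- The range `[a, a)` is empty. This settles the initial condition and fixes the constant of
integration when a fractional derivative is inverted. -/
theorem fracIntegral_self (𝕋 : Set ℝ) (a β : ℝ) (g : ℝ → ℝ) : fracIntegral 𝕋 a β g a = 0 := by
  rw [fracIntegral_eq, Ico_self, Measure.restrict_empty, integral_zero_measure, zero_div]

theorem fracIntegral_one_of_subset (hat : a ≤ t) (h : Icc a t ⊆ 𝕋) (g : ℝ → ℝ) :
    fracIntegral 𝕋 a 1 g t = ∫ s in a..t, g s := by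
  rw [fracIntegral_eq_of_subset hat h, intervalIntegral.integral_of_le hat,
    ← integral_Ico_eq_integral_Ioc]
  simp

/-- The semigroup property of the Riemann–Liouville integrals on an interval. -/
theorem fracIntegral_fracIntegral (hp : 0 < p) (hq : 0 < q) (hat : a ≤ t) (h : Icc a t ⊆ 𝕋)
    (hg : ContinuousOn g (Icc a t)) :
    fracIntegral 𝕋 a p (fracIntegral 𝕋 a q g) t = fracIntegral 𝕋 a (p + q) g t := by
  have hp' := (Real.Gamma_pos_of_pos hp).ne'
  have hq' := (Real.Gamma_pos_of_pos hq).ne'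
  have h1 : ∫ s in Ico a t, (t - s) ^ (p - 1) * fracIntegral 𝕋 a q g s =
      (∫ s in Ico a t, (t - s) ^ (p - 1) * ∫ r in Ico a s, (s - r) ^ (q - 1) * g r) /
        Real.Gamma q := by
    rw [← integral_div]
    refine setIntegral_congr_fun measurableSet_Ico fun s hs => ?_
    rw [fracIntegral_eq_of_subset hs.1 ((Icc_subset_Icc_right hs.2.le).trans h), mul_div_assoc]
  rw [fracIntegral_eq_of_subset hat h, fracIntegral_eq_of_subset hat h, h1,
    setIntegral_kernel_setIntegral_kernel hp hq hat hg]
  field_simp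

theorem forwardJump_eq_self (h : Icc a T ⊆ 𝕋) (ht : t ∈ Ico a T) : forwardJump 𝕋 t = t := by
  have hsub : Ioo t T ⊆ 𝕋 ∩ Ioi t := fun s hs => ⟨h ⟨ht.1.trans hs.1.le, hs.2.le⟩, hs.1⟩
  have hne : (Ioo t T).Nonempty := nonempty_Ioo.2 ht.2
  rw [forwardJump, if_pos (hne.mono hsub)]
  refine le_antisymm ?_ (le_csInf (hne.mono hsub) fun s hs => le_of_lt hs.2)
  calc sInf (𝕋 ∩ Ioi t) ≤ sInf (Ioo t T) := csInf_le_csInf ⟨t, fun s hs => le_of_lt hs.2⟩ hne hsub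
    _ = t := csInf_Ioo ht.2

/-- In the interior of an interval contained in the time scale, the delta derivative is the
ordinary derivative. -/
theorem hasDeltaDerivAt_iff (h : Icc a T ⊆ 𝕋) (ht : t ∈ Ioo a T) {F : ℝ → ℝ} :
    HasDeltaDerivAt 𝕋 F d t ↔ HasDerivAt F d t := by
  have hn : 𝓝[𝕋] t = 𝓝 t :=
    nhdsWithin_eq_nhds.2 (mem_of_superset (Icc_mem_nhds ht.1 ht.2) h)
  rw [HasDeltaDerivAt, forwardJump_eq_self h ⟨ht.1.le, ht.2⟩, hn, hasDerivAt_iff_isLittleO,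
    Asymptotics.isLittleO_iff]
  refine forall₂_congr fun ε _ => eventually_congr (Eventually.of_forall fun s => ?_)
  rw [Real.norm_eq_abs, Real.norm_eq_abs, abs_sub_comm s t,
    ← abs_neg (F s - F t - (s - t) • d), smul_eq_mul]
  ring_nf

theorem hasFracDerivAt_iff (h : Icc a T ⊆ 𝕋) (ht : t ∈ Ioo a T) :
    HasFracDerivAt 𝕋 a β g d t ↔ HasDerivAt (fracIntegral 𝕋 a (1 - β) g) d t := by
  rw [HasFracDerivAt, hasDeltaDerivAt_iff h ht]
  unfold fracIntegral
  -- The kernel exponents agree: `(1 - β) - 1 = -β`.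
  rw [sub_sub_cancel_left]

theorem hasDerivAt_fracIntegral_one (h : Icc a T ⊆ 𝕋) (hg : ContinuousOn g (Icc a T))
    (ht : t ∈ Ioo a T) : HasDerivAt (fracIntegral 𝕋 a 1 g) (g t) t := by
  have h1 : HasDerivAt (fun x => ∫ s in a..x, g s) (g t) t := by
    refine intervalIntegral.integral_hasDerivAt_right ?_ ?_
      (hg.continuousAt (Icc_mem_nhds ht.1 ht.2))
    · exact (hg.mono (Icc_subset_Icc_right ht.2.le)).intervalIntegrable_of_Icc ht.1.le
    · exact (hg.mono Ioo_subset_Icc_self).stronglyMeasurableAtFilter isOpen_Ioo t ht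
  refine h1.congr_of_eventuallyEq ?_
  filter_upwards [Ioo_mem_nhds ht.1 ht.2] with x hx
  exact fracIntegral_one_of_subset hx.1.le ((Icc_subset_Icc_right hx.2.le).trans h) g

/-- By the semigroup property `I^{1-β} I^β g = I^1 g`, whose derivative is `g`. -/
theorem hasFracDerivAt_fracIntegral (h : Icc a T ⊆ 𝕋) (hβ : 0 < β) (hβ1 : β < 1)
    (hg : ContinuousOn g (Icc a T)) (ht : t ∈ Ioo a T) :
    HasFracDerivAt 𝕋 a β (fracIntegral 𝕋 a β g) (g t) t := by
  rw [hasFracDerivAt_iff h ht]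
  refine (hasDerivAt_fracIntegral_one h hg ht).congr_of_eventuallyEq ?_
  filter_upwards [Ioo_mem_nhds ht.1 ht.2] with x hx
  have hsub := Icc_subset_Icc_right (b := a) hx.2.le
  rw [fracIntegral_fracIntegral (sub_pos.2 hβ1) hβ hx.1.le (hsub.trans h) (hg.mono hsub),
    sub_add_cancel]

/-- A continuous function is determined by its Riemann–Liouville derivative. -/
theorem eqOn_fracIntegral_of_hasFracDerivAt (h𝕋 : IsClosed 𝕋) (haT : a < T)
    (h : Icc a T ⊆ 𝕋) (hβ : 0 < β) (hβ1 : β < 1) {v : ℝ → ℝ} (hv : ContinuousOn v (Icc a T)) (hg : ContinuousOn g (Icc a T))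
    (hd : ∀ t ∈ Ioo a T, HasFracDerivAt 𝕋 a β v (g t) t) :
    EqOn v (fracIntegral 𝕋 a β g) (Icc a T) := by
  have hS : 𝕋 ∩ Icc a T = Icc a T := inter_eq_right.2 h
  have ha : a ∈ 𝕋 := h (left_mem_Icc.2 haT.le)
  have hcont : ∀ {r : ℝ} {w : ℝ → ℝ}, 0 < r → r ≤ 1 → ContinuousOn w (Icc a T) →
      ContinuousOn (fracIntegral 𝕋 a r w) (Icc a T) := by
    intro r w hr hr1 hw
    rw [← hS] at hw ⊢
    exact continuousOn_fracIntegral h𝕋 ha hr hr1 hw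
  have hF := hcont (sub_pos.2 hβ1) (by linarith) hv
  have hu := hcont hβ hβ1.le hg
  -- The equation says `(I^{1-β} v)' = g`; integrate, using that `I^{1-β} v` vanishes at `a`.
  have hI1 : ∀ t ∈ Icc a T, fracIntegral 𝕋 a (1 - β) v t = fracIntegral 𝕋 a 1 g t := by
    intro t ht
    have hsub := Icc_subset_Icc_right (b := a) ht.2
    rw [fracIntegral_one_of_subset ht.1 (hsub.trans h),
      intervalIntegral.integral_eq_sub_of_hasDerivAt_of_le ht.1 (hF.mono hsub)
      (fun x hx => (hasFracDerivAt_iff h ⟨hx.1, hx.2.trans_le ht.2⟩).1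
        (hd x ⟨hx.1, hx.2.trans_le ht.2⟩))
      ((hg.mono hsub).intervalIntegrable_of_Icc ht.1), fracIntegral_self, sub_zero]
  -- Apply `I^β` to the previous identity: the left side becomes `I^1 v`, and the right side is
  -- rewritten through `I^1 g = I^{1-β} I^β g`. Differentiating then gives `v = I^β g` in the
  -- interior, and continuity gives it at the endpoints.
  have hI2 : ∀ t ∈ Icc a T, fracIntegral 𝕋 a 1 v t =
      fracIntegral 𝕋 a 1 (fracIntegral 𝕋 a β g) t := by
    intro t ht
    have hsub := Icc_subset_Icc_right (b := a) ht.2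
    have e1 := fracIntegral_fracIntegral hβ (sub_pos.2 hβ1) ht.1 (hsub.trans h) (hv.mono hsub)
    have e2 := fracIntegral_fracIntegral hβ (sub_pos.2 hβ1) ht.1 (hsub.trans h) (hu.mono hsub)
    rw [add_sub_cancel] at e1 e2
    rw [← e1, ← e2]
    refine fracIntegral_congr h𝕋 fun s hs => ?_
    have hs' : s ∈ Icc a T := ⟨hs.2.1, hs.2.2.le.trans ht.2⟩
    have hsub' := Icc_subset_Icc_right (b := a) hs'.2
    rw [hI1 s hs', fracIntegral_fracIntegral (sub_pos.2 hβ1) hβ hs'.1 (hsub'.trans h)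
      (hg.mono hsub'), sub_add_cancel]
  have hIoo : EqOn v (fracIntegral 𝕋 a β g) (Ioo a T) := by
    intro t ht
    refine (hasDerivAt_fracIntegral_one h hv ht).unique
      ((hasDerivAt_fracIntegral_one h hu ht).congr_of_eventuallyEq ?_)
    filter_upwards [Icc_mem_nhds ht.1 ht.2] with x hx using hI2 x hx
  have := hIoo.of_subset_closure hv hu Ioo_subset_Icc_self
  exact this (by rw [closure_Ioo haT.ne])

end FracIntegral

/-! ### Estimates for the source term and for delta integrals -/

/-- Vary the numerator and the denominator separately, with `X² - Y² = (X - Y)(X + Y)` and `X + Y ≤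
2cT`. Later `m = c₁ T` and `D` is the Lipschitz constant times the distance of two functions; the
two summands yield the two terms of the bound on `λ`. -/
theorem abs_div_sq_sub_div_sq_le {x y X Y m c D T : ℝ} (hm : 0 < m) (hT : 0 ≤ T)
    (hy : 0 ≤ y) (hyc : y ≤ c) (hX : m ≤ X) (hXc : X ≤ c * T) (hY : m ≤ Y) (hYc : Y ≤ c * T)
    (hxy : |x - y| ≤ D) (hXY : |X - Y| ≤ D * T) :
    |x / X ^ 2 - y / Y ^ 2| ≤ D * (1 / m ^ 2 + 2 * c ^ 2 * T ^ 2 / m ^ 4) := by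
  have hX0 : 0 < X := hm.trans_le hX
  have hY0 : 0 < Y := hm.trans_le hY
  have hD : 0 ≤ D := (abs_nonneg _).trans hxy
  have hc : 0 ≤ c := hy.trans hyc
  have e : x / X ^ 2 - y / Y ^ 2 =
      (x - y) / X ^ 2 - y * ((X - Y) * (X + Y)) / (X ^ 2 * Y ^ 2) := by
    field_simp
    ring
  rw [e]
  refine (abs_sub _ _).trans ?_
  have h1 : |(x - y) / X ^ 2| ≤ D / m ^ 2 := by
    rw [abs_div, abs_of_pos (pow_pos hX0 2)]
    gcongr
  have h2 : |y * ((X - Y) * (X + Y)) / (X ^ 2 * Y ^ 2)| ≤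
      c * (D * T * (c * T + c * T)) / (m ^ 2 * m ^ 2) := by
    rw [abs_div, abs_mul, abs_mul, abs_of_nonneg hy, abs_of_pos (add_pos hX0 hY0),
      abs_of_pos (mul_pos (pow_pos hX0 2) (pow_pos hY0 2))]
    gcongr
  calc _ ≤ D / m ^ 2 + c * (D * T * (c * T + c * T)) / (m ^ 2 * m ^ 2) := add_le_add h1 h2
    _ = _ := by
      field_simp
      ring

section DeltaIntegral

variable {𝕋 : Set ℝ} {a b c D : ℝ} {g h : ℝ → ℝ}

theorem integrableOn_of_continuousOn (h𝕋 : IsClosed 𝕋) (ha : a ∈ 𝕋) (hb : b ∈ 𝕋)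
    (hg : ContinuousOn g (𝕋 ∩ Icc a b)) : IntegrableOn g (Ico a b) (deltaMeasure 𝕋) := by
  obtain ⟨M, hM⟩ := (isCompact_Icc.inter_left h𝕋).exists_bound_of_continuousOn hg
  have := isFiniteMeasure_deltaMeasure_restrict ha hb
  refine Integrable.of_bound (aestronglyMeasurable_of_continuousOn h𝕋 le_rfl hg) M ?_
  filter_upwards [ae_mem_deltaMeasure_restrict h𝕋 a b] with s hs
    using hM s ⟨hs.1, Ico_subset_Icc_self hs.2⟩

theorem deltaIntegral_const (ha : a ∈ 𝕋) (hb : b ∈ 𝕋) (hab : a ≤ b) (c : ℝ) :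
    deltaIntegral 𝕋 a b (fun _ => c) = c * (b - a) := by
  rw [deltaIntegral, setIntegral_const, measureReal_def, deltaMeasure_Ico ha hb,
    ENNReal.toReal_ofReal (sub_nonneg.2 hab), smul_eq_mul, mul_comm]

theorem deltaIntegral_mono (h𝕋 : IsClosed 𝕋) (ha : a ∈ 𝕋) (hb : b ∈ 𝕋)
    (hg : ContinuousOn g (𝕋 ∩ Icc a b)) (hh : ContinuousOn h (𝕋 ∩ Icc a b))
    (hgh : ∀ s ∈ 𝕋 ∩ Icc a b, g s ≤ h s) : deltaIntegral 𝕋 a b g ≤ deltaIntegral 𝕋 a b h := by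
  refine integral_mono_ae (integrableOn_of_continuousOn h𝕋 ha hb hg)
    (integrableOn_of_continuousOn h𝕋 ha hb hh) ?_
  filter_upwards [ae_mem_deltaMeasure_restrict h𝕋 a b] with s hs
    using hgh s ⟨hs.1, Ico_subset_Icc_self hs.2⟩

theorem le_deltaIntegral (h𝕋 : IsClosed 𝕋) (ha : a ∈ 𝕋) (hb : b ∈ 𝕋) (hab : a ≤ b)
    (hg : ContinuousOn g (𝕋 ∩ Icc a b)) (hc : ∀ s ∈ 𝕋 ∩ Icc a b, c ≤ g s) :
    c * (b - a) ≤ deltaIntegral 𝕋 a b g := by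
  rw [← deltaIntegral_const ha hb hab]
  exact deltaIntegral_mono h𝕋 ha hb continuousOn_const hg hc

theorem deltaIntegral_le (h𝕋 : IsClosed 𝕋) (ha : a ∈ 𝕋) (hb : b ∈ 𝕋) (hab : a ≤ b)
    (hg : ContinuousOn g (𝕋 ∩ Icc a b)) (hc : ∀ s ∈ 𝕋 ∩ Icc a b, g s ≤ c) :
    deltaIntegral 𝕋 a b g ≤ c * (b - a) := by
  rw [← deltaIntegral_const ha hb hab]
  exact deltaIntegral_mono h𝕋 ha hb hg continuousOn_const hc

theorem abs_deltaIntegral_sub_le (h𝕋 : IsClosed 𝕋) (ha : a ∈ 𝕋) (hb : b ∈ 𝕋) (hab : a ≤ b)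
    (hg : ContinuousOn g (𝕋 ∩ Icc a b)) (hh : ContinuousOn h (𝕋 ∩ Icc a b))
    (hD : ∀ s ∈ 𝕋 ∩ Icc a b, |g s - h s| ≤ D) :
    |deltaIntegral 𝕋 a b g - deltaIntegral 𝕋 a b h| ≤ D * (b - a) := by
  have e : deltaIntegral 𝕋 a b g - deltaIntegral 𝕋 a b h =
      deltaIntegral 𝕋 a b (fun s => g s - h s) :=
    (integral_sub (integrableOn_of_continuousOn h𝕋 ha hb hg)
      (integrableOn_of_continuousOn h𝕋 ha hb hh)).symm
  rw [e, abs_le, ← neg_mul]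
  exact ⟨le_deltaIntegral h𝕋 ha hb hab (hg.sub hh) fun s hs => (abs_le.1 (hD s hs)).1,
    deltaIntegral_le h𝕋 ha hb hab (hg.sub hh) fun s hs => (abs_le.1 (hD s hs)).2⟩

end DeltaIntegral

theorem operatorK_eq_fracIntegral (𝕋 : Set ℝ) (T α lam : ℝ) (f u : ℝ → ℝ) (t : ℝ) :
    operatorK 𝕋 T α lam f u t = fracIntegral 𝕋 0 (2 * α) (source 𝕋 T lam f u) t := by
  unfold operatorK fracIntegral source
  -- The nonlocal factor does not depend on `s`; naming it keeps the next unfolding on the outer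
  -- integrals.
  generalize deltaIntegral 𝕋 0 T (fun x => f (u x)) = A
  rw [deltaIntegral, deltaIntegral, ← integral_const_mul]
  refine integral_congr_ae (Eventually.of_forall fun s => ?_)
  ring

/-- Two nonlinearities are allowed so that `f` can be exchanged for an extension of it from `[0,
∞)`. -/
theorem source_congr {𝕋 : Set ℝ} (h𝕋 : IsClosed 𝕋) {T lam : ℝ} {f g u v : ℝ → ℝ}
    (h : ∀ t ∈ 𝕋 ∩ Icc 0 T, f (u t) = g (v t)) :
    EqOn (source 𝕋 T lam f u) (source 𝕋 T lam g v) (𝕋 ∩ Icc 0 T) := by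
  intro t ht
  rw [source, source, h t ht, deltaIntegral_congr h𝕋
    (fun s hs => h s ⟨hs.1, Ico_subset_Icc_self hs.2⟩)]

/-! ### The contraction and its fixed point -/

section Contraction

variable {𝕋 : Set ℝ} {T γ lam c₁ c₂ : ℝ} {f u v : ℝ → ℝ} {L : ℝ≥0}

theorem continuousOn_source (hf : Continuous f) (hu : ContinuousOn u (𝕋 ∩ Icc 0 T)) :
    ContinuousOn (source 𝕋 T lam f u) (𝕋 ∩ Icc 0 T) :=
  ((hf.comp_continuousOn hu).const_mul lam).div_const _

theorem source_nonneg (hlam : 0 ≤ lam) (hf : ∀ x, 0 ≤ f x) (t : ℝ) :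
    0 ≤ source 𝕋 T lam f u t :=
  div_nonneg (mul_nonneg hlam (hf _)) (sq_nonneg _)

theorem abs_fracIntegral_source_sub_le (h𝕋 : IsClosed 𝕋) (hT : 0 < T) (h0_mem : (0 : ℝ) ∈ 𝕋)
    (hT_mem : T ∈ 𝕋) (hγ : 0 < γ) (hγ1 : γ ≤ 1) (hlam : 0 ≤ lam) (hc₁ : 0 < c₁)
    (hL : LipschitzWith L f) (hf : ∀ x, c₁ ≤ f x ∧ f x ≤ c₂) {D : ℝ} (hD0 : 0 ≤ D)
    (hu : ContinuousOn u (𝕋 ∩ Icc 0 T)) (hv : ContinuousOn v (𝕋 ∩ Icc 0 T))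
    (hD : ∀ t ∈ 𝕋 ∩ Icc 0 T, |u t - v t| ≤ D) {t : ℝ} (ht : t ∈ 𝕋 ∩ Icc 0 T) :
    |fracIntegral 𝕋 0 γ (source 𝕋 T lam f u) t - fracIntegral 𝕋 0 γ (source 𝕋 T lam f v) t| ≤
      lam * L * (1 / (c₁ * T) ^ 2 + 2 * c₂ ^ 2 * T ^ 2 / (c₁ * T) ^ 4) * T ^ γ /
        Real.Gamma (γ + 1) * D := by
  have hfu := hL.continuous.comp_continuousOn hu
  have hfv := hL.continuous.comp_continuousOn hv
  have hsu := continuousOn_source (lam := lam) hL.continuous hu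
  have hsv := continuousOn_source (lam := lam) hL.continuous hv
  have hΓ := Real.Gamma_pos_of_pos (add_pos hγ one_pos)
  have hfuv : ∀ s ∈ 𝕋 ∩ Icc 0 T, |f (u s) - f (v s)| ≤ L * D := fun s hs =>
    (hL.dist_le_mul (u s) (v s)).trans (mul_le_mul_of_nonneg_left (hD s hs) L.2)
  have hbound : ∀ w : ℝ → ℝ, ContinuousOn (f ∘ w) (𝕋 ∩ Icc 0 T) →
      c₁ * T ≤ deltaIntegral 𝕋 0 T (fun x => f (w x)) ∧
      deltaIntegral 𝕋 0 T (fun x => f (w x)) ≤ c₂ * T := by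
    intro w hw
    have h1 := le_deltaIntegral (c := c₁) h𝕋 h0_mem hT_mem hT.le hw fun s _ => (hf _).1
    have h2 := deltaIntegral_le (c := c₂) h𝕋 h0_mem hT_mem hT.le hw fun s _ => (hf _).2
    rw [sub_zero] at h1 h2
    exact ⟨h1, h2⟩
  have hdiff := abs_deltaIntegral_sub_le h𝕋 h0_mem hT_mem hT.le hfu hfv hfuv
  rw [sub_zero] at hdiff
  have hc₂ : 0 ≤ c₂ := hc₁.le.trans ((hf 0).1.trans (hf 0).2)
  set E := 1 / (c₁ * T) ^ 2 + 2 * c₂ ^ 2 * T ^ 2 / (c₁ * T) ^ 4 with hE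
  have hE0 : 0 ≤ E := by positivity
  have hpt : ∀ s ∈ 𝕋 ∩ Ico 0 t,
      |source 𝕋 T lam f u s - source 𝕋 T lam f v s| ≤ lam * (L * D * E) := by
    intro s hs
    have hs' : s ∈ 𝕋 ∩ Icc 0 T := ⟨hs.1, hs.2.1, hs.2.2.le.trans ht.2.2⟩
    rw [source, source, mul_div_assoc, mul_div_assoc, ← mul_sub, abs_mul, abs_of_nonneg hlam]
    refine mul_le_mul_of_nonneg_left ?_ hlam
    exact abs_div_sq_sub_div_sq_le (by positivity) hT.le (hc₁.le.trans (hf _).1) (hf _).2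
      (hbound u hfu).1 (hbound u hfu).2 (hbound v hfv).1 (hbound v hfv).2 (hfuv s hs') hdiff
  -- These bounds serve only integrability in `fracIntegral_sub`; they do not enter the contraction
  -- constant.
  obtain ⟨M₁, hM₁⟩ := (isCompact_Icc.inter_left h𝕋).exists_bound_of_continuousOn hsu
  obtain ⟨M₂, hM₂⟩ := (isCompact_Icc.inter_left h𝕋).exists_bound_of_continuousOn hsv
  rw [fracIntegral_sub (M := max M₁ M₂) h𝕋 h0_mem ht.1 ht.2.1 hγ hγ1
    (aestronglyMeasurable_of_continuousOn h𝕋 ht.2.2 hsu)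
    (fun s hs => (hM₁ s ⟨hs.1, hs.2.1, hs.2.2.le.trans ht.2.2⟩).trans (le_max_left _ _))
    (aestronglyMeasurable_of_continuousOn h𝕋 ht.2.2 hsv)
    (fun s hs => (hM₂ s ⟨hs.1, hs.2.1, hs.2.2.le.trans ht.2.2⟩).trans (le_max_right _ _))]
  refine (abs_fracIntegral_le h𝕋 h0_mem ht.1 ht.2.1 hγ hγ1 (by positivity) hpt).trans ?_
  have htT : (t - 0) ^ γ ≤ T ^ γ := by
    rw [sub_zero]
    exact Real.rpow_le_rpow ht.2.1 ht.2.2 hγ.le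
  calc lam * (L * D * E) * (t - 0) ^ γ / Real.Gamma (γ + 1)
      ≤ lam * (L * D * E) * T ^ γ / Real.Gamma (γ + 1) := by gcongr
    _ = _ := by ring

/-- Banach's fixed point theorem for `u ↦ I^γ (λ f(u) / (∫ f(u))²)` on `C([0, T]_𝕋)`. -/
theorem exists_unique_fixedPoint (h𝕋 : IsClosed 𝕋) (hT : 0 < T) (h0_mem : (0 : ℝ) ∈ 𝕋)
    (hT_mem : T ∈ 𝕋) (hγ : 0 < γ) (hγ1 : γ ≤ 1) (hlam : 0 ≤ lam) (hc₁ : 0 < c₁)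
    (hL : LipschitzWith L f) (hf : ∀ x, c₁ ≤ f x ∧ f x ≤ c₂)
    (hq : lam * L * (1 / (c₁ * T) ^ 2 + 2 * c₂ ^ 2 * T ^ 2 / (c₁ * T) ^ 4) * T ^ γ /
        Real.Gamma (γ + 1) < 1) :
    ∃ u : ℝ → ℝ, (ContinuousOn u (𝕋 ∩ Icc 0 T) ∧
        EqOn u (fracIntegral 𝕋 0 γ (source 𝕋 T lam f u)) (𝕋 ∩ Icc 0 T)) ∧
      ∀ v : ℝ → ℝ, ContinuousOn v (𝕋 ∩ Icc 0 T) →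
        EqOn v (fracIntegral 𝕋 0 γ (source 𝕋 T lam f v)) (𝕋 ∩ Icc 0 T) →
        EqOn v u (𝕋 ∩ Icc 0 T) := by
  set S : Set ℝ := 𝕋 ∩ Icc 0 T with hS
  set q := lam * L * (1 / (c₁ * T) ^ 2 + 2 * c₂ ^ 2 * T ^ 2 / (c₁ * T) ^ 4) * T ^ γ /
        Real.Gamma (γ + 1) with hq_def
  have hc₂ : 0 ≤ c₂ := hc₁.le.trans ((hf 0).1.trans (hf 0).2)
  have hq0 : 0 ≤ q := by
    have := Real.Gamma_pos_of_pos (add_pos hγ one_pos)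
    positivity
  have : CompactSpace S := isCompact_iff_compactSpace.1 (isCompact_Icc.inter_left h𝕋)
  have hcont : ∀ w : ℝ → ℝ, ContinuousOn w S →
      ContinuousOn (fracIntegral 𝕋 0 γ (source 𝕋 T lam f w)) S := fun w hw =>
    continuousOn_fracIntegral h𝕋 h0_mem hγ hγ1 (continuousOn_source hL.continuous hw)
  -- The value 0 off `S` is immaterial, since the delta integrals involved see only points of `S`.
  let ext : C(S, ℝ) → ℝ → ℝ := fun w => Function.extend Subtype.val w 0
  have ext_apply : ∀ (w : C(S, ℝ)) (t : S), ext w t = w t := fun w t =>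
    Subtype.val_injective.extend_apply _ _ t
  have ext_cont : ∀ w : C(S, ℝ), ContinuousOn (ext w) S := by
    intro w
    rw [continuousOn_iff_continuous_domRestrict]
    exact w.continuous.congr fun t => (ext_apply w t).symm
  let Φ : C(S, ℝ) → C(S, ℝ) := fun w =>
    ⟨S.domRestrict (fracIntegral 𝕋 0 γ (source 𝕋 T lam f (ext w))),
      (hcont _ (ext_cont w)).domRestrict⟩
  have hΦ : ContractingWith q.toNNReal Φ := by
    refine ⟨by rwa [Real.toNNReal_lt_one], LipschitzWith.of_dist_le_mul fun w₁ w₂ => ?_⟩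
    rw [Real.coe_toNNReal q hq0, ContinuousMap.dist_le (mul_nonneg hq0 dist_nonneg)]
    intro t
    refine abs_fracIntegral_source_sub_le h𝕋 hT h0_mem hT_mem hγ hγ1 hlam hc₁ hL hf dist_nonneg
      (ext_cont w₁) (ext_cont w₂) (fun s hs => ?_) t.2
    have := ContinuousMap.dist_apply_le_dist (f := w₁) (g := w₂) ⟨s, hs⟩
    rwa [← ext_apply, ← ext_apply] at this
  refine ⟨ext (ContractingWith.fixedPoint Φ hΦ), ⟨ext_cont _, fun t ht => ?_⟩, fun v hv hfix => ?_⟩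
  · have := DFunLike.congr_fun (ContractingWith.fixedPoint_isFixedPt hΦ) (⟨t, ht⟩ : S)
    rw [← ext_apply, ← ext_apply] at this
    rw [← this, ext_apply]
    rfl
  · let w : C(S, ℝ) := ⟨S.domRestrict v, hv.domRestrict⟩
    have hwv : EqOn (ext w) v S := fun t ht => ext_apply w ⟨t, ht⟩
    have hw : Function.IsFixedPt Φ w := by
      ext t
      have e : fracIntegral 𝕋 0 γ (source 𝕋 T lam f (ext w)) t =
          fracIntegral 𝕋 0 γ (source 𝕋 T lam f v) t :=
        fracIntegral_congr h𝕋 ((source_congr h𝕋 fun s hs => by rw [hwv hs]).mono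
          (inter_subset_inter_right _ (Ico_subset_Icc_self.trans (Icc_subset_Icc_right t.2.2.2))))
      exact e.trans (hfix t.2).symm
    rw [← hΦ.fixedPoint_unique hw]
    exact hwv.symm

end Contraction

/-- The constant is `λ` times the bracket, as `T^{2(α+1)} = T^{2α} T²`. The case `L = 0` is separate
because there `0⁻¹ = 0` instead of `+∞`. -/
theorem contraction_constant_lt_one {T α c₁ c₂ lam : ℝ} {L : ℝ≥0} (hT : 0 < T) (hα : 0 < α)
    (hc₁ : 0 < c₁)
    (hlam : L = 0 ∨ lam < (T ^ (2 * α) * L / ((c₁ * T) ^ 2 * Real.Gamma (2 * α + 1))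
        + 2 * c₂ ^ 2 * T ^ (2 * (α + 1)) * L
          / ((c₁ * T) ^ 4 * Real.Gamma (2 * α + 1)))⁻¹) :
    lam * L * (1 / (c₁ * T) ^ 2 + 2 * c₂ ^ 2 * T ^ 2 / (c₁ * T) ^ 4) * T ^ (2 * α) /
        Real.Gamma (2 * α + 1) < 1 := by
  rcases eq_or_ne L 0 with h0 | h0
  · simp [h0]
  have hL : (0 : ℝ) < L := NNReal.coe_pos.2 (pos_iff_ne_zero.2 h0)
  have hΓ : 0 < Real.Gamma (2 * α + 1) := Real.Gamma_pos_of_pos (by positivity)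
  have hTα : 0 < T ^ (2 * α) := Real.rpow_pos_of_pos hT _
  have hpow : T ^ (2 * (α + 1)) = T ^ (2 * α) * T ^ 2 := by
    rw [mul_add, mul_one, Real.rpow_add hT, Real.rpow_two]
  have h1 := hlam.resolve_left h0
  rw [hpow] at h1
  set X := T ^ (2 * α) * L / ((c₁ * T) ^ 2 * Real.Gamma (2 * α + 1)) +
    2 * c₂ ^ 2 * (T ^ (2 * α) * T ^ 2) * L / ((c₁ * T) ^ 4 * Real.Gamma (2 * α + 1)) with hX
  have hX0 : 0 < X := by positivity
  calc _ = lam * X := by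
        rw [hX]
        field_simp
    _ < X⁻¹ * X := mul_lt_mul_of_pos_right h1 hX0
    _ = 1 := inv_mul_cancel₀ hX0.ne'

end TimeScale

/-! ### The theorem -/

open TimeScale in
theorem theorem6p2 (𝕋 : Set ℝ) (h𝕋 : IsClosed 𝕋) (T : ℝ) (hT : 0 < T)
    (h0_mem : (0 : ℝ) ∈ 𝕋) (hT_mem : T ∈ 𝕋)
    (α : ℝ) (hα_pos : 0 < α) (hα_lt : α < 1 / 2)
    (f : ℝ → ℝ) (Lf : ℝ≥0) (c₁ c₂ : ℝ) (hc₁ : 0 < c₁)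
    (hf_lip : LipschitzOnWith Lf f (Ici 0))
    (hf_bdd : ∀ x, 0 ≤ x → c₁ ≤ f x ∧ f x ≤ c₂)
    (lam : ℝ) (hlam_pos : 0 < lam)
    (hlam_lt : Lf = 0 ∨
      lam < (T ^ (2 * α) * Lf / ((c₁ * T) ^ 2 * Real.Gamma (2 * α + 1))
        + 2 * c₂ ^ 2 * T ^ (2 * (α + 1)) * Lf
          / ((c₁ * T) ^ 4 * Real.Gamma (2 * α + 1)))⁻¹) :
    ∃ u : ℝ → ℝ,
      (TimeScale.IsIntegralSolution 𝕋 T α lam f u ∧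
        ∀ v : ℝ → ℝ, TimeScale.IsIntegralSolution 𝕋 T α lam f v →
          EqOn v u (𝕋 ∩ Icc 0 T)) ∧
      (Icc 0 T ⊆ 𝕋 →
        TimeScale.IsDifferentialSolution 𝕋 T α lam f u ∧
          ∀ v : ℝ → ℝ, TimeScale.IsDifferentialSolution 𝕋 T α lam f v →
            EqOn v u (𝕋 ∩ Icc 0 T)) := by
  -- Truncation extends `f` to `ℝ` with the same Lipschitz constant and bounds, so the fixed point
  -- theorem applies on all of `C([0,T]_𝕋)`. The fixed point is nonnegative, being the fractional
  -- integral of a nonnegative source, so there `fc` and `f` agree.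
  set fc : ℝ → ℝ := fun x => f (max x 0) with hfc
  have hL : LipschitzWith Lf fc := by
    refine LipschitzWith.of_dist_le_mul fun x y => ?_
    refine (hf_lip.dist_le_mul _ (le_max_right x 0) _ (le_max_right y 0)).trans ?_
    gcongr
    exact abs_max_sub_max_le_abs x y 0
  have hbd : ∀ x, c₁ ≤ fc x ∧ fc x ≤ c₂ := fun x => hf_bdd _ (le_max_right x 0)
  have hγ : 0 < 2 * α := by linarith
  have hγ1 : 2 * α < 1 := by linarith
  obtain ⟨u, ⟨hu_cont, hu_fix⟩, hu_unique⟩ := exists_unique_fixedPoint h𝕋 hT h0_mem hT_mem hγ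
    hγ1.le hlam_pos.le hc₁ hL hbd (contraction_constant_lt_one hT hα_pos hc₁ hlam_lt)
  have hsource : ∀ v : ℝ → ℝ, (∀ t ∈ 𝕋 ∩ Icc 0 T, 0 ≤ v t) →
      EqOn (source 𝕋 T lam f v) (source 𝕋 T lam fc v) (𝕋 ∩ Icc 0 T) := fun v hv =>
    source_congr h𝕋 fun t ht => by rw [hfc]; simp only [max_eq_left (hv t ht)]
  have hK : ∀ v : ℝ → ℝ, (∀ t ∈ 𝕋 ∩ Icc 0 T, 0 ≤ v t) → ∀ t ∈ 𝕋 ∩ Icc 0 T,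
      operatorK 𝕋 T α lam f v t = fracIntegral 𝕋 0 (2 * α) (source 𝕋 T lam fc v) t := by
    intro v hv t ht
    rw [operatorK_eq_fracIntegral]
    exact fracIntegral_congr h𝕋 ((hsource v hv).mono
      (inter_subset_inter_right _ (Ico_subset_Icc_self.trans (Icc_subset_Icc_right ht.2.2))))
  have hu_nonneg : ∀ t ∈ 𝕋 ∩ Icc 0 T, 0 ≤ u t := by
    intro t ht
    rw [hu_fix ht]
    exact fracIntegral_nonneg h𝕋 hγ fun s _ =>
      source_nonneg hlam_pos.le (fun x => hc₁.le.trans (hbd x).1) s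
  refine ⟨u, ⟨⟨hu_cont, hu_nonneg, fun t ht => ?_⟩, fun v hv => ?_⟩, fun hsub => ?_⟩
  · rw [hK u hu_nonneg t ht]
    exact hu_fix ht
  · exact hu_unique v hv.continuousOn fun t ht => by rw [hv.fixed t ht, hK v hv.nonneg t ht]
  · have hS : 𝕋 ∩ Icc 0 T = Icc 0 T := inter_eq_right.2 hsub
    have hsc : ∀ v : ℝ → ℝ, ContinuousOn v (𝕋 ∩ Icc 0 T) →
        ContinuousOn (source 𝕋 T lam fc v) (Icc 0 T) := fun v hv => by
      rw [← hS]
      exact continuousOn_source hL.continuous hv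
    refine ⟨⟨hu_cont, hu_nonneg, fun t ht => ?_, fun β _ => fracIntegral_self 𝕋 0 β u⟩,
      fun v hv => hu_unique v hv.continuousOn ?_⟩
    · have htS : t ∈ 𝕋 ∩ Icc 0 T := ⟨ht.1, Ioo_subset_Icc_self ht.2⟩
      have h1 := hasFracDerivAt_fracIntegral hsub hγ hγ1 (hsc u hu_cont) ht.2
      rw [hasFracDerivAt_iff hsub ht.2] at h1 ⊢
      rw [hsource u hu_nonneg htS]
      refine h1.congr_of_eventuallyEq ?_
      filter_upwards [Ioo_mem_nhds ht.2.1 ht.2.2] with x hx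
      exact fracIntegral_congr h𝕋 (hu_fix.mono
        (inter_subset_inter_right _ (Ico_subset_Icc_self.trans (Icc_subset_Icc_right hx.2.le))))
    -- Inverting the fractional derivative makes `v` a fixed point of the same operator, to which
    -- uniqueness applies.
    · have h1 := eqOn_fracIntegral_of_hasFracDerivAt h𝕋 hT hsub hγ hγ1 (hS ▸ hv.continuousOn)
        (hsc v hv.continuousOn) fun t ht => by
          rw [← hsource v hv.nonneg ⟨hsub (Ioo_subset_Icc_self ht), Ioo_subset_Icc_self ht⟩]
          exact hv.equation t ⟨hsub (Ioo_subset_Icc_self ht), ht⟩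
      rwa [hS]
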